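/- Let $\mathbb M_{n_1,n_2}$ be the space of real or complex $n_1\times n_2$ matrices with the Frobenius norm $\|\cdot\|_F$, let $\mathcal A$ be a real-linear map from $\mathbb M_{n_1,n_2}$ to $\mathbb R^m$ or $\mathbb C^m$ (with the Euclidean norm $\|\cdot\|_2$), and let $\mu\ge 0$. Write $\sigma_1(X)\ge\sigma_2(X)\ge\dots\ge\sigma_{\min(n_1,n_2)}(X)\ge 0$ for the singular values of $X$, put $r_\mu(s)=\mu-\max(\sqrt\mu-s,0)^2$, and define $\delta_k^-$ by $$1-\delta_k^-=\inf\left\{\frac{\|\mathcal A X\|_2^2}{\|X\|_F^2}:\ X\ne 0,\ \operatorname{rank}(X)\le k\right\}.$$ Call $X$ a stationary point of a functional $g$ on $\mathbb M_{n_1,n_2}$ if $$\liminf_{Y\to X,\ Y\ne X}\frac{g(Y)-g(X)}{\|Y-X\|_F}\ge 0 .$$ Suppose that $b=\mathcal A X_0$ where $\operatorname{rank}(X_0)=K\ge 1$, that $0<\delta_{2K}^-<1$, and that $$\sigma_K(X_0)>\frac{\sqrt\mu}{1-\delta_{2K}^-}.$$ Then $X_0$ is a stationary point of $$\mathcal R(X)=\sum_{i=1}^{\min(n_1,n_2)}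 r_\mu(\sigma_i(X))+\|\mathcal A X-b\|_2^2 ,$$ it is the unique minimizer of $\mathcal R$ among matrices of rank at most $K$, i.e. $$\operatorname*{arg\,min}_{\operatorname{rank}(X)\le K}\mathcal R(X)=\{X_0\},$$ and every stationary point $X\ne X_0$ of $\mathcal R$ satisfies $\operatorname{rank}(X)>K$. -/

import Mathlib

open Filter Topology

noncomputable section

namespace LowRank

-- Matrices are normed by the Frobenius norm.
attribute [local instance] Matrix.frobeniusNormedAddCommGroup

/-- `X` is a stationary point of `g` if `liminf_{Y → X, Y ≠ X} (g Y - g X) / ‖Y - X‖ ≥ 0`,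
the lower limit being taken in the extended reals. -/
def IsStationaryPoint {E : Type*} [NormedAddCommGroup E] (g : E → ℝ) (X : E) : Prop :=
  (0 : EReal) ≤ liminf (fun Y => (((g Y - g X) / ‖Y - X‖ : ℝ) : EReal)) (𝓝[≠] X)

variable {𝕜 : Type*} [RCLike 𝕜] {n₁ n₂ : ℕ}

/-- Singular values of a matrix in non-increasing order, counted from zero: `singularValue X i` is
the number usually written `σ_{i+1}(X)`. -/
def singularValue (X : Matrix (Fin n₁) (Fin n₂) 𝕜) (i : ℕ) : ℝ :=
  (Matrix.toEuclideanLin X).singularValues i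

/-- `r_μ(s) = μ - max(√μ - s, 0)²`. -/
def rPenalty (μ s : ℝ) : ℝ := μ - max (√μ - s) 0 ^ 2

variable {𝕂 : Type*} [RCLike 𝕂] {m : ℕ}

/-- The lower restricted isometry constant `δ_k⁻` of `A`, determined by
`1 - δ_k⁻ = inf {‖A X‖² / ‖X‖_F² : X ≠ 0, rank X ≤ k}`. -/
def lripConst (A : Matrix (Fin n₁) (Fin n₂) 𝕜 →ₗ[ℝ] EuclideanSpace 𝕂 (Fin m)) (k : ℕ) : ℝ :=
  1 - sInf {q : ℝ | ∃ X : Matrix (Fin n₁) (Fin n₂) 𝕜,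
    X ≠ 0 ∧ X.rank ≤ k ∧ q = ‖A X‖ ^ 2 / ‖X‖ ^ 2}

/-- The functional `X ↦ ∑ᵢ r_μ(σᵢ(X)) + ‖A X - b‖²`, the sum being over all `min n₁ n₂` singular
values. -/
def regFunctional (A : Matrix (Fin n₁) (Fin n₂) 𝕜 →ₗ[ℝ] EuclideanSpace 𝕂 (Fin m))
    (b : EuclideanSpace 𝕂 (Fin m)) (μ : ℝ) (X : Matrix (Fin n₁) (Fin n₂) 𝕜) : ℝ :=
  ∑ i ∈ Finset.range (min n₁ n₂), rPenalty μ (singularValue X i) + ‖A X - b‖ ^ 2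

/-- `X` is a stationary point, with respect to the Frobenius norm, of the functional above. -/
def IsStationaryReg (A : Matrix (Fin n₁) (Fin n₂) 𝕜 →ₗ[ℝ] EuclideanSpace 𝕂 (Fin m))
    (b : EuclideanSpace 𝕂 (Fin m)) (μ : ℝ) (X : Matrix (Fin n₁) (Fin n₂) 𝕜) : Prop :=
  IsStationaryPoint (regFunctional A b μ) X

end LowRank

end

/-!
Since `s ↦ r_μ(√s)` is concave, the spectral penalty `P(T) = ∑ r_μ(σᵢ(T))` is at most
`∑ r_μ(‖T wₖ‖)` for every orthonormal family `w` outside whose span `T` vanishes. With `w` made of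
singular vectors of `X`, this gives upper bounds, exact to first order, for `P` along two directions
summing to `D = X₀ - X`. Along the block of `D` from `ker X` to `range X` the first-order term is
zero, as one sees by passing to adjoints. Along the rest of `D`, singular vectors `uᵢ`, `vᵢ` of `X`
can be completed by those of the block from `ker X` to `(range X)ᗮ`, and the first-order term is
`2 ∑ max(√μ - σᵢ, 0) Re ⟨uᵢ, D vᵢ⟩`.

The overlaps of the singular vectors of two maps form a doubly substochastic matrix, which reduces
inequalities about pairs of maps to inequalities about pairs of singular values. If the nonzero
singular values of `X₀` are at least `√μ / c`, where `c ≤ 1`, then `P(X₀) ≤ P(X) + c ‖X - X₀‖²`,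
and the first-order term above is at most `2 c ‖X - X₀‖²`. A stationary point `X` therefore
satisfies `‖A (X - X₀)‖² ≤ c ‖X - X₀‖²`. For `c = √μ / σ_K < 1 - δ` the lower isometry bound rules
this out if `X ≠ X₀` has rank at most `K`, and the bound on `P(X₀)` makes `X₀` the unique minimizer.
-/

open scoped InnerProductSpace

noncomputable section

namespace LowRank

section Scalar

variable {μ c s x y : ℝ}

lemma rPenalty_zero (hμ : 0 ≤ μ) : rPenalty μ 0 = 0 := by
  simp [rPenalty, Real.sq_sqrt hμ]

lemma rPenalty_le (μ s : ℝ) : rPenalty μ s ≤ μ :=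
  sub_le_self _ (sq_nonneg _)

lemma rPenalty_nonneg (hμ : 0 ≤ μ) (hs : 0 ≤ s) : 0 ≤ rPenalty μ s := by
  rw [rPenalty, sub_nonneg]
  calc max (√μ - s) 0 ^ 2 ≤ √μ ^ 2 := by
        gcongr
        exact max_le (sub_le_self _ hs) (Real.sqrt_nonneg μ)
    _ = μ := Real.sq_sqrt hμ

lemma rPenalty_le_linear (hμ : 0 ≤ μ) (s : ℝ) : rPenalty μ s ≤ 2 * √μ * s := by
  have hsq := Real.sq_sqrt hμ
  rcases le_total s √μ with h | h
  · rw [rPenalty, max_eq_left (sub_nonneg.2 h)]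
    nlinarith [sq_nonneg s]
  · nlinarith [rPenalty_le μ s, Real.sqrt_nonneg μ]

-- The function `s ↦ r_μ(√s)` is concave; the right-hand side is its tangent at `x²`.
lemma rPenalty_le_tangent (hx : 0 < x) (s : ℝ) :
    rPenalty μ s ≤ rPenalty μ x + max (√μ - x) 0 / x * (s ^ 2 - x ^ 2) := by
  simp only [rPenalty]
  rcases le_total √μ x with hμx | hxμ
  · rw [max_eq_right (a := √μ - x) (by linarith)]
    simp
  rw [max_eq_left (a := √μ - x) (by linarith)]
  have tangent_sub (t : ℝ) :
      (√μ - x) / x * (t ^ 2 - x ^ 2) - (√μ - x) ^ 2 + (√μ - t) ^ 2 = √μ / x * (t - x) ^ 2 := by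
    field_simp
    ring
  have tangent_le (t : ℝ) : (√μ - x) ^ 2 - (√μ - t) ^ 2 ≤ (√μ - x) / x * (t ^ 2 - x ^ 2) := by
    have : 0 ≤ √μ / x * (t - x) ^ 2 := by positivity
    linarith [tangent_sub t]
  rcases le_total s √μ with h | h
  · rw [max_eq_left (by linarith)]
    linarith [tangent_le s]
  · rw [max_eq_right (by linarith)]
    have hmono : (√μ - x) / x * (√μ ^ 2 - x ^ 2) ≤ (√μ - x) / x * (s ^ 2 - x ^ 2) := by
      have : 0 ≤ (√μ - x) / x := div_nonneg (by linarith) hx.le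
      gcongr
    linarith [tangent_le √μ]

lemma sum_mul_rPenalty_le {ι : Type*} [Fintype ι] {p s : ι → ℝ} (hμ : 0 ≤ μ)
    (hp : ∀ i, 0 ≤ p i) (hp₁ : ∑ i, p i ≤ 1) (hx : 0 ≤ x) (hxs : x ^ 2 = ∑ i, p i * s i ^ 2) :
    ∑ i, p i * rPenalty μ (s i) ≤ rPenalty μ x := by
  rcases hx.eq_or_lt with rfl | hx
  · have hterm : ∀ i, p i * s i ^ 2 = 0 := by
      have := (Finset.sum_eq_zero_iff_of_nonneg (s := .univ) (f := fun i => p i * s i ^ 2)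
        fun i _ => mul_nonneg (hp i) (sq_nonneg _)).1 (by rw [← hxs]; norm_num)
      simpa using this
    rw [rPenalty_zero hμ]
    refine Finset.sum_nonpos fun i _ => ?_
    rcases mul_eq_zero.1 (hterm i) with h | h
    · simp [h]
    · simp [pow_eq_zero_iff two_ne_zero |>.1 h, rPenalty_zero hμ]
  set k := max (√μ - x) 0 / x
  have hk : 0 ≤ rPenalty μ x - k * x ^ 2 := by
    have := rPenalty_le_tangent (μ := μ) hx 0
    rw [rPenalty_zero hμ] at this
    linarith
  calc ∑ i, p i * rPenalty μ (s i)
      ≤ ∑ i, p i * (rPenalty μ x + k * (s i ^ 2 - x ^ 2)) := by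
        gcongr with i
        · exact hp i
        · exact rPenalty_le_tangent hx (s i)
    _ = (∑ i, p i) * (rPenalty μ x - k * x ^ 2) + k * ∑ i, p i * s i ^ 2 := by
        rw [Finset.sum_mul, Finset.mul_sum, ← Finset.sum_add_distrib]
        exact Finset.sum_congr rfl fun i _ => by ring
    _ ≤ rPenalty μ x := by
        rw [← hxs]
        linarith [mul_le_of_le_one_left hk hp₁]

lemma max_sub_le (hc : 0 ≤ c) (hx : √μ ≤ c * x) (hc₁ : c ≤ 1) (hy : 0 ≤ y) :
    max (√μ - y) 0 ≤ c * |x - y| := by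
  refine max_le ?_ (by positivity)
  calc √μ - y ≤ c * (x - y) := by linarith [mul_le_of_le_one_left hy hc₁]
    _ ≤ c * |x - y| := mul_le_mul_of_nonneg_left (le_abs_self _) hc

lemma max_mul_sub_le (hc : 0 ≤ c) (hc₁ : c ≤ 1) (hx : √μ ≤ c * x) (hy : 0 ≤ y) :
    max (√μ - y) 0 * (x - y) ≤ c * (y - x) ^ 2 :=
  calc max (√μ - y) 0 * (x - y) ≤ max (√μ - y) 0 * |x - y| := by
        gcongr
        exact le_abs_self _
    _ ≤ c * |x - y| * |x - y| := by
        gcongr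
        exact max_sub_le hc hx hc₁ hy
    _ = c * (y - x) ^ 2 := by rw [mul_assoc, abs_mul_abs_self]; ring

lemma rPenalty_le_add_mul_sq (hc : 0 ≤ c) (hc₁ : c ≤ 1) (hx : √μ ≤ c * x) (hy : 0 ≤ y) :
    rPenalty μ x ≤ rPenalty μ y + c * (y - x) ^ 2 := by
  have hmax := max_sub_le hc hx hc₁ hy
  have hsq : max (√μ - y) 0 ^ 2 ≤ c * (y - x) ^ 2 :=
    calc max (√μ - y) 0 ^ 2 ≤ (c * |x - y|) ^ 2 := by gcongr
      _ = c * (c * (y - x) ^ 2) := by rw [mul_pow, sq_abs]; ring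
      _ ≤ c * (y - x) ^ 2 := mul_le_of_le_one_left (by positivity) hc₁
  have hμy : rPenalty μ y = μ - max (√μ - y) 0 ^ 2 := rfl
  linarith [rPenalty_le μ x]

end Scalar

section Substochastic

variable {ι κ : Type*} [Fintype ι] [Fintype κ] {p : ι → κ → ℝ} {y q : ι → ℝ} {x : κ → ℝ}
  {μ c : ℝ}

/-- Doubly substochastic matrices: nonnegative entries, with row and column sums at most one. -/
structure IsDoublySubstochastic (p : ι → κ → ℝ) : Prop where
  nonneg : ∀ i j, 0 ≤ p i j
  row_sum_le : ∀ i, ∑ j, p i j ≤ 1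
  col_sum_le : ∀ j, ∑ i, p i j ≤ 1

lemma sum_one_sub_row_mul (p : ι → κ → ℝ) (f : ι → ℝ) :
    ∑ i, (1 - ∑ j, p i j) * f i = ∑ i, f i - ∑ i, ∑ j, p i j * f i := by
  simp only [sub_mul, one_mul, Finset.sum_sub_distrib, Finset.sum_mul]

lemma sum_one_sub_col_mul (p : ι → κ → ℝ) (f : κ → ℝ) :
    ∑ j, (1 - ∑ i, p i j) * f j = ∑ j, f j - ∑ i, ∑ j, p i j * f j := by
  rw [sum_one_sub_row_mul (fun j i => p i j), Finset.sum_comm (s := .univ (α := κ))]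

namespace IsDoublySubstochastic

lemma sum_row_mul_le (hp : IsDoublySubstochastic p) (hy : ∀ i, 0 ≤ y i) :
    ∑ i, ∑ j, p i j * y i ≤ ∑ i, y i := by
  refine Finset.sum_le_sum fun i _ => ?_
  rw [← Finset.sum_mul]
  exact mul_le_of_le_one_left (hy i) (hp.row_sum_le i)

/-- If `p` dominates the overlaps of the singular vectors of `Y` and `X`, with singular values `y`
and `x`, the right-hand side is `‖Y - X‖²`. -/
lemma sum_mul_sq_sub_add_le (hp : IsDoublySubstochastic p) (hy : ∀ i, 0 ≤ y i)
    (hq : ∀ i, q i ≤ ∑ j, p i j * x j) :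
    ∑ i, ∑ j, p i j * (y i - x j) ^ 2 + ∑ j, (1 - ∑ i, p i j) * x j ^ 2
      ≤ ∑ i, y i ^ 2 + ∑ j, x j ^ 2 - 2 * ∑ i, y i * q i := by
  have hcross : ∑ i, y i * q i ≤ ∑ i, ∑ j, p i j * (y i * x j) := by
    refine Finset.sum_le_sum fun i _ => (mul_le_mul_of_nonneg_left (hq i) (hy i)).trans_eq ?_
    rw [Finset.mul_sum]
    exact Finset.sum_congr rfl fun j _ => by ring
  have hexpand : ∑ i, ∑ j, p i j * (y i - x j) ^ 2 = ∑ i, ∑ j, p i j * y i ^ 2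
      + ∑ i, ∑ j, p i j * x j ^ 2 - 2 * ∑ i, ∑ j, p i j * (y i * x j) := by
    simp only [Finset.mul_sum, ← Finset.sum_add_distrib, ← Finset.sum_sub_distrib]
    exact Finset.sum_congr rfl fun i _ => Finset.sum_congr rfl fun j _ => by ring
  linarith [sum_one_sub_col_mul p fun j => x j ^ 2, hp.sum_row_mul_le fun i => sq_nonneg (y i)]

lemma sum_rPenalty_le (hp : IsDoublySubstochastic p) (hμ : 0 ≤ μ) (hc : 0 ≤ c) (hc₁ : c ≤ 1)
    (hx : ∀ j, √μ ≤ c * x j) (hy : ∀ i, 0 ≤ y i) (hq : ∀ i, q i ≤ ∑ j, p i j * x j) :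
    ∑ j, rPenalty μ (x j) ≤ ∑ i, rPenalty μ (y i)
      + c * (∑ i, y i ^ 2 + ∑ j, x j ^ 2 - 2 * ∑ i, y i * q i) := by
  have hmatched : ∑ i, ∑ j, p i j * rPenalty μ (x j) ≤
      ∑ i, ∑ j, p i j * rPenalty μ (y i) + c * ∑ i, ∑ j, p i j * (y i - x j) ^ 2 := by
    simp only [Finset.mul_sum, ← Finset.sum_add_distrib]
    refine Finset.sum_le_sum fun i _ => Finset.sum_le_sum fun j _ => ?_
    have := mul_le_mul_of_nonneg_left
      (rPenalty_le_add_mul_sq hc hc₁ (hx j) (hy i)) (hp.nonneg i j)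
    linarith
  have hunmatched : ∑ j, (1 - ∑ i, p i j) * rPenalty μ (x j)
      ≤ c * ∑ j, (1 - ∑ i, p i j) * x j ^ 2 := by
    rw [Finset.mul_sum]
    refine Finset.sum_le_sum fun j _ => ?_
    have hr : rPenalty μ (x j) ≤ c * x j ^ 2 := by
      simpa [rPenalty_zero hμ] using rPenalty_le_add_mul_sq hc hc₁ (hx j) le_rfl
    linarith [mul_le_mul_of_nonneg_left hr (sub_nonneg.2 (hp.col_sum_le j))]
  linarith [mul_le_mul_of_nonneg_left (hp.sum_mul_sq_sub_add_le hy hq) hc,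
    sum_one_sub_col_mul p fun j => rPenalty μ (x j),
    hp.sum_row_mul_le fun i => rPenalty_nonneg hμ (hy i)]

lemma sum_max_mul_sub_le (hp : IsDoublySubstochastic p) (hc : 0 ≤ c) (hc₁ : c ≤ 1)
    (hx : ∀ j, √μ ≤ c * x j) (hy : ∀ i, 0 ≤ y i) (hq : ∀ i, q i ≤ ∑ j, p i j * x j) :
    ∑ i, max (√μ - y i) 0 * (q i - y i)
      ≤ c * (∑ i, y i ^ 2 + ∑ j, x j ^ 2 - 2 * ∑ i, y i * q i) := by
  have hmatched : ∑ i, max (√μ - y i) 0 * (q i - y i)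
      ≤ c * ∑ i, ∑ j, p i j * (y i - x j) ^ 2 := by
    rw [Finset.mul_sum]
    refine Finset.sum_le_sum fun i _ => ?_
    calc max (√μ - y i) 0 * (q i - y i)
        ≤ max (√μ - y i) 0 * (∑ j, p i j * x j - (∑ j, p i j) * y i) := by
          gcongr
          · exact hq i
          · exact mul_le_of_le_one_left (hy i) (hp.row_sum_le i)
      _ = ∑ j, p i j * (max (√μ - y i) 0 * (x j - y i)) := by
          rw [Finset.sum_mul, ← Finset.sum_sub_distrib, Finset.mul_sum]
          exact Finset.sum_congr rfl fun j _ => by ring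
      _ ≤ c * ∑ j, p i j * (y i - x j) ^ 2 := by
          rw [Finset.mul_sum]
          refine Finset.sum_le_sum fun j _ => ?_
          linarith [mul_le_mul_of_nonneg_left
            (max_mul_sub_le hc hc₁ (hx j) (hy i)) (hp.nonneg i j)]
  have hunmatched : 0 ≤ ∑ j, (1 - ∑ i, p i j) * x j ^ 2 :=
    Finset.sum_nonneg fun j _ => mul_nonneg (sub_nonneg.2 (hp.col_sum_le j)) (sq_nonneg _)
  calc ∑ i, max (√μ - y i) 0 * (q i - y i) ≤ c * ∑ i, ∑ j, p i j * (y i - x j) ^ 2 := hmatched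
    _ ≤ _ := mul_le_mul_of_nonneg_left
      (by linarith [hp.sum_mul_sq_sub_add_le hy hq]) hc

end IsDoublySubstochastic

end Substochastic

section UpperSlope

/-- `φ` has slope at most `β` at `0` from the right, with a quadratic error bound. At a stationary
point every such `β` along a line is nonnegative. -/
def IsUpperSlope (φ : ℝ → ℝ) (β : ℝ) : Prop :=
  ∃ C : ℝ, ∀ t : ℝ, 0 < t → φ t ≤ φ 0 + t * β + C * t ^ 2

namespace IsUpperSlope

variable {φ ψ : ℝ → ℝ} {β γ : ℝ}

lemma mono (hψ : IsUpperSlope ψ β) (h₀ : φ 0 = ψ 0) (h : ∀ t, 0 < t → φ t ≤ ψ t) :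
    IsUpperSlope φ β := by
  obtain ⟨C, hC⟩ := hψ
  exact ⟨C, fun t ht => h₀ ▸ (h t ht).trans (hC t ht)⟩

lemma add (hφ : IsUpperSlope φ β) (hψ : IsUpperSlope ψ γ) :
    IsUpperSlope (fun t => φ t + ψ t) (β + γ) := by
  obtain ⟨C, hC⟩ := hφ
  obtain ⟨C', hC'⟩ := hψ
  exact ⟨C + C', fun t ht => by linarith [hC t ht, hC' t ht]⟩

lemma sum {ι : Type*} [Fintype ι] {φ : ι → ℝ → ℝ} {β : ι → ℝ}
    (h : ∀ i, IsUpperSlope (φ i) (β i)) : IsUpperSlope (fun t => ∑ i, φ i t) (∑ i, β i) := by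
  choose C hC using h
  refine ⟨∑ i, C i, fun t ht => ?_⟩
  rw [Finset.mul_sum, Finset.sum_mul, ← Finset.sum_add_distrib, ← Finset.sum_add_distrib]
  exact Finset.sum_le_sum fun i _ => hC i t ht

end IsUpperSlope

variable {𝕜 : Type*} [RCLike 𝕜] {H : Type*} [NormedAddCommGroup H] [InnerProductSpace 𝕜 H]
  {μ : ℝ}

lemma norm_add_ofReal_smul_sq (a d : H) (t : ℝ) : ‖a + (t : 𝕜) • d‖ ^ 2
    = ‖a‖ ^ 2 + t * (2 * RCLike.re ⟪a, d⟫_𝕜) + ‖d‖ ^ 2 * t ^ 2 := by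
  rw [norm_add_sq (𝕜 := 𝕜), inner_smul_right, RCLike.re_ofReal_mul, norm_smul, mul_pow,
    RCLike.norm_ofReal, sq_abs]
  ring

lemma isUpperSlope_norm_sq (a d : H) :
    IsUpperSlope (fun t => ‖a + (t : 𝕜) • d‖ ^ 2) (2 * RCLike.re ⟪a, d⟫_𝕜) :=
  ⟨‖d‖ ^ 2, fun t _ => by simp [norm_add_ofReal_smul_sq a d t]⟩

lemma isUpperSlope_rPenalty_norm {a : H} (ha : a ≠ 0) (d : H) :
    IsUpperSlope (fun t => rPenalty μ ‖a + (t : 𝕜) • d‖)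
      (max (√μ - ‖a‖) 0 / ‖a‖ * (2 * RCLike.re ⟪a, d⟫_𝕜)) := by
  refine ⟨max (√μ - ‖a‖) 0 / ‖a‖ * ‖d‖ ^ 2, fun t _ => ?_⟩
  refine (rPenalty_le_tangent (norm_pos_iff.2 ha) _).trans_eq ?_
  simp only [norm_add_ofReal_smul_sq, RCLike.ofReal_zero, zero_smul, add_zero]
  ring

lemma isUpperSlope_rPenalty_norm_smul (hμ : 0 ≤ μ) (d : H) :
    IsUpperSlope (fun t => rPenalty μ ‖(t : 𝕜) • d‖) (2 * √μ * ‖d‖) := by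
  refine ⟨0, fun t ht => (rPenalty_le_linear hμ _).trans_eq ?_⟩
  simp only [RCLike.ofReal_zero, zero_smul, norm_zero, rPenalty_zero hμ, norm_smul,
    RCLike.norm_ofReal, abs_of_pos ht]
  ring

end UpperSlope

section Stationary

variable {E : Type*} [NormedAddCommGroup E] {g : E → ℝ} {X D : E} {β : ℝ}

lemma isStationaryPoint_iff :
    IsStationaryPoint g X ↔ ∀ ε > 0, ∀ᶠ Y in 𝓝 X, g X - ε * ‖Y - X‖ ≤ g Y := by
  rw [IsStationaryPoint, le_liminf_iff]
  constructor
  · intro h ε hε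
    have hev := eventually_nhdsWithin_iff.1 (h (-ε : ℝ) (by exact_mod_cast neg_neg_of_pos hε))
    filter_upwards [hev] with Y hY
    rcases eq_or_ne Y X with rfl | hne
    · simp
    · have hquot := EReal.coe_lt_coe_iff.1 (hY hne)
      rw [lt_div_iff₀ (norm_sub_pos_iff.2 hne)] at hquot
      linarith
  · intro h z hz
    obtain ⟨r, hzr, hr⟩ := EReal.lt_iff_exists_real_btwn.1 hz
    have hr : r < 0 := by exact_mod_cast hr
    filter_upwards [(h (-r) (neg_pos.2 hr)).filter_mono nhdsWithin_le_nhds,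
      self_mem_nhdsWithin] with Y hY (hne : Y ≠ X)
    refine hzr.trans_le (EReal.coe_le_coe_iff.2 ?_)
    rw [le_div_iff₀ (norm_sub_pos_iff.2 hne)]
    linarith

lemma isStationaryPoint_of_le_add_sq (h : ∀ Y, g X ≤ g Y + ‖Y - X‖ ^ 2) :
    IsStationaryPoint g X := by
  refine isStationaryPoint_iff.2 fun ε hε => ?_
  filter_upwards [Metric.ball_mem_nhds X hε] with Y hY
  rw [mem_ball_iff_norm] at hY
  nlinarith [h Y, norm_nonneg (Y - X)]

lemma IsStationaryPoint.nonneg_of_isUpperSlope {𝕜 : Type*} [RCLike 𝕜] [NormedSpace 𝕜 E]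
    (hX : IsStationaryPoint g X) (hβ : IsUpperSlope (fun t => g (X + (t : 𝕜) • D)) β) :
    0 ≤ β := by
  obtain ⟨C, hC⟩ := hβ
  have hcurve : Tendsto (fun t : ℝ => X + (t : 𝕜) • D) (𝓝[>] 0) (𝓝 X) := by
    simpa using (by fun_prop : Continuous fun t : ℝ => X + (t : 𝕜) • D).continuousWithinAt
      (s := Set.Ioi 0) (x := 0) |>.tendsto
  have hslope : Tendsto (fun t : ℝ => β + C * t) (𝓝[>] 0) (𝓝 β) := by
    simpa using (by fun_prop : Continuous fun t : ℝ => β + C * t).continuousWithinAt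
      (s := Set.Ioi 0) (x := 0) |>.tendsto
  have hbound : ∀ ε > 0, -(ε * ‖D‖) ≤ β := fun ε hε => by
    refine ge_of_tendsto hslope ?_
    filter_upwards [hcurve.eventually (isStationaryPoint_iff.1 hX ε hε), self_mem_nhdsWithin]
      with t hlower (ht : 0 < t)
    have hupper := hC t ht
    simp only [RCLike.ofReal_zero, zero_smul, add_zero] at hupper
    simp only [add_sub_cancel_left, norm_smul, RCLike.norm_ofReal, abs_of_pos ht] at hlower
    refine le_of_mul_le_mul_left ?_ ht
    linarith
  have hlim : Tendsto (fun ε : ℝ => -(ε * ‖D‖)) (𝓝[>] 0) (𝓝 0) := by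
    simpa using (by fun_prop : Continuous fun ε : ℝ => -(ε * ‖D‖)).continuousWithinAt
      (s := Set.Ioi 0) (x := 0) |>.tendsto
  exact le_of_tendsto hlim (eventually_mem_nhdsWithin.mono hbound)

end Stationary

section SVD

variable {𝕜 : Type*} [RCLike 𝕜]
  {E : Type*} [NormedAddCommGroup E] [InnerProductSpace 𝕜 E]
  {F : Type*} [NormedAddCommGroup F] [InnerProductSpace 𝕜 F]
  {ι κ : Type*}

lemma orthonormal_sumElim {v : ι → E} {w : κ → E} (hv : Orthonormal 𝕜 v) (hw : Orthonormal 𝕜 w)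
    (hvw : ∀ i k, ⟪v i, w k⟫_𝕜 = 0) : Orthonormal 𝕜 (Sum.elim v w) := by
  refine ⟨Sum.rec hv.norm_eq_one hw.norm_eq_one, ?_⟩
  rintro (i | k) (j | l) hne
  · exact hv.inner_eq_zero (ne_of_apply_ne _ hne)
  · exact hvw i l
  · exact inner_eq_zero_symm.1 (hvw j k)
  · exact hw.inner_eq_zero (ne_of_apply_ne _ hne)

variable [Fintype ι] [Fintype κ]

/-- A singular value decomposition `T = ∑ᵢ sᵢ ⟨vᵢ, ·⟩ uᵢ` with orthonormal families `v` and `u`,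
neither of which need be complete. -/
structure IsSVD (T : E →ₗ[𝕜] F) (v : ι → E) (s : ι → ℝ) (u : ι → F) : Prop where
  orthonormal_right : Orthonormal 𝕜 v
  orthonormal_left : Orthonormal 𝕜 u
  nonneg : ∀ i, 0 ≤ s i
  apply_eq_sum : ∀ z, T z = ∑ i, (s i * ⟪v i, z⟫_𝕜) • u i

namespace IsSVD

variable {T : E →ₗ[𝕜] F} {v : ι → E} {s : ι → ℝ} {u : ι → F} {μ : ℝ}

lemma apply_right (h : IsSVD T v s u) (i : ι) : T (v i) = (s i : 𝕜) • u i := by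
  classical
  simp [h.apply_eq_sum, orthonormal_iff_ite.1 h.orthonormal_right]

lemma norm_apply_right (h : IsSVD T v s u) (i : ι) : ‖T (v i)‖ = s i := by
  rw [h.apply_right, norm_smul, h.orthonormal_left.norm_eq_one, mul_one, RCLike.norm_ofReal,
    abs_of_nonneg (h.nonneg i)]

lemma apply_eq_zero (h : IsSVD T v s u) {z : E} (hz : ∀ i, ⟪v i, z⟫_𝕜 = 0) : T z = 0 := by
  simp [h.apply_eq_sum, hz]

lemma inner_left_apply (h : IsSVD T v s u) (i : ι) (z : E) :
    ⟪u i, T z⟫_𝕜 = s i * ⟪v i, z⟫_𝕜 := by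
  rw [h.apply_eq_sum, h.orthonormal_left.inner_right_fintype]

lemma inner_right_eq_zero (h : IsSVD T v s u) {i : ι} (hi : s i ≠ 0) {z : E} (hz : T z = 0) :
    ⟪v i, z⟫_𝕜 = 0 := by
  have := h.inner_left_apply i z
  rw [hz, inner_zero_right, eq_comm, mul_eq_zero] at this
  exact this.resolve_left (by exact_mod_cast hi)

lemma right_mem_orthogonal_ker (h : IsSVD T v s u) {i : ι} (hi : s i ≠ 0) : v i ∈ T.kerᗮ :=
  (Submodule.mem_orthogonal' _ _).2 fun _ hz => h.inner_right_eq_zero hi hz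

lemma left_mem_range (h : IsSVD T v s u) {i : ι} (hi : s i ≠ 0) : u i ∈ T.range :=
  ⟨(s i : 𝕜)⁻¹ • v i, by rw [map_smul, h.apply_right, inv_smul_smul₀ (by exact_mod_cast hi)]⟩

lemma norm_sq_apply (h : IsSVD T v s u) (z : E) :
    ‖T z‖ ^ 2 = ∑ i, ‖⟪v i, z⟫_𝕜‖ ^ 2 * s i ^ 2 := by
  have hinner : ⟪T z, T z⟫_𝕜 = ((∑ i, ‖⟪v i, z⟫_𝕜‖ ^ 2 * s i ^ 2 : ℝ) : 𝕜) := by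
    rw [h.apply_eq_sum, h.orthonormal_left.inner_sum]
    push_cast
    refine Finset.sum_congr rfl fun i _ => ?_
    rw [RCLike.conj_mul, norm_mul, RCLike.norm_ofReal, abs_of_nonneg (h.nonneg i)]
    push_cast
    ring
  rw [inner_self_eq_norm_sq_to_K] at hinner
  exact_mod_cast hinner

lemma sum_norm_inner_sq_eq_one (h : IsSVD T v s u) {i : ι} (hi : s i ≠ 0) {w : κ → E}
    (hw : Orthonormal 𝕜 w) (hT : ∀ z, (∀ k, ⟪w k, z⟫_𝕜 = 0) → T z = 0) :
    ∑ k, ‖⟪v i, w k⟫_𝕜‖ ^ 2 = 1 := by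
  have hresidual : ⟪v i, v i - ∑ k, ⟪w k, v i⟫_𝕜 • w k⟫_𝕜 = 0 :=
    h.inner_right_eq_zero hi <| hT _ fun k => by
      rw [inner_sub_right, hw.inner_right_fintype, sub_self]
  rw [inner_sub_right, inner_sum, inner_self_eq_norm_sq_to_K, h.orthonormal_right.norm_eq_one,
    sub_eq_zero] at hresidual
  have hterm : ∀ k, ⟪v i, ⟪w k, v i⟫_𝕜 • w k⟫_𝕜 = ((‖⟪v i, w k⟫_𝕜‖ ^ 2 : ℝ) : 𝕜) := fun k => by
    rw [inner_smul_right, ← inner_conj_symm, RCLike.conj_mul]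
    push_cast
    rfl
  simp only [hterm, RCLike.ofReal_one, one_pow] at hresidual
  exact_mod_cast hresidual.symm

lemma sum_rPenalty_le (h : IsSVD T v s u) (hμ : 0 ≤ μ) {w : κ → E} (hw : Orthonormal 𝕜 w)
    (hT : ∀ z, (∀ k, ⟪w k, z⟫_𝕜 = 0) → T z = 0) :
    ∑ i, rPenalty μ (s i) ≤ ∑ k, rPenalty μ ‖T (w k)‖ := by
  calc ∑ i, rPenalty μ (s i) = ∑ i, ∑ k, ‖⟪v i, w k⟫_𝕜‖ ^ 2 * rPenalty μ (s i) := by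
        refine Finset.sum_congr rfl fun i _ => ?_
        rcases eq_or_ne (s i) 0 with hi | hi
        · simp [hi, rPenalty_zero hμ]
        · rw [← Finset.sum_mul, h.sum_norm_inner_sq_eq_one hi hw hT, one_mul]
    _ = ∑ k, ∑ i, ‖⟪v i, w k⟫_𝕜‖ ^ 2 * rPenalty μ (s i) := Finset.sum_comm
    _ ≤ ∑ k, rPenalty μ ‖T (w k)‖ := by
        refine Finset.sum_le_sum fun k _ => sum_mul_rPenalty_le hμ (fun i => by positivity) ?_
          (norm_nonneg _) (h.norm_sq_apply _)
        simpa [hw.norm_eq_one] using h.orthonormal_right.sum_inner_products_le (w k) (s := .univ)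

variable [FiniteDimensional 𝕜 E] [FiniteDimensional 𝕜 F]

lemma adjoint (h : IsSVD T v s u) :
    IsSVD T.adjoint u s v where
  orthonormal_right := h.orthonormal_left
  orthonormal_left := h.orthonormal_right
  nonneg := h.nonneg
  apply_eq_sum z := by
    refine ext_inner_left 𝕜 fun w => ?_
    rw [LinearMap.adjoint_inner_right, h.apply_eq_sum, sum_inner, inner_sum]
    refine Finset.sum_congr rfl fun i _ => ?_
    simp only [inner_smul_left, inner_smul_right, map_mul, RCLike.conj_ofReal, inner_conj_symm]
    ring

lemma sumElim_zero {S : E →ₗ[𝕜] F} {v' : κ → E} {s' : κ → ℝ} {u' : κ → F} (h : IsSVD T v s u)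
    (h' : IsSVD S v' s' u') (hs' : ∀ k, s' k ≠ 0) (hv : ∀ i, S (v i) = 0)
    (hu : ∀ i, S.adjoint (u i) = 0) :
    IsSVD T (Sum.elim v v') (Sum.elim s 0) (Sum.elim u u') where
  orthonormal_right := orthonormal_sumElim h.orthonormal_right h'.orthonormal_right fun i k =>
    inner_eq_zero_symm.1 (h'.inner_right_eq_zero (hs' k) (hv i))
  orthonormal_left := orthonormal_sumElim h.orthonormal_left h'.orthonormal_left fun i k =>
    inner_eq_zero_symm.1 (h'.adjoint.inner_right_eq_zero (hs' k) (hu i))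
  nonneg := by simpa using h.nonneg
  apply_eq_sum z := by simp [h.apply_eq_sum]

end IsSVD

variable [FiniteDimensional 𝕜 E] [FiniteDimensional 𝕜 F]

lemma singularValues_ne_zero (T : E →ₗ[𝕜] F) (i : Fin (Module.finrank 𝕜 T.range)) :
    T.singularValues i ≠ 0 :=
  (T.singularValues_pos_iff_lt_finrank_range.2 i.2).ne'

lemma exists_isSVD (T : E →ₗ[𝕜] F) :
    ∃ (v : Fin (Module.finrank 𝕜 T.range) → E) (u : Fin (Module.finrank 𝕜 T.range) → F),
      IsSVD T v (fun i => T.singularValues i) u := by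
  set b := T.isSymmetric_adjoint_comp_self.eigenvectorBasis rfl
  have hle : Module.finrank 𝕜 T.range ≤ Module.finrank 𝕜 E := T.finrank_range_le
  have hinner (i j) : ⟪T (b i), T (b j)⟫_𝕜 = ((T.singularValues j : 𝕜) ^ 2) * ⟪b i, b j⟫_𝕜 := by
    rw [← LinearMap.adjoint_inner_right, ← LinearMap.comp_apply,
      T.isSymmetric_adjoint_comp_self.apply_eigenvectorBasis rfl j, inner_smul_right,
      ← T.sq_singularValues_fin rfl j, RCLike.ofReal_pow]
  have hnull (j : Fin (Module.finrank 𝕜 E)) (hj : T.singularValues j = 0) : T (b j) = 0 := by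
    rw [← inner_self_eq_zero (𝕜 := 𝕜), hinner, hj]
    simp
  have hpos (i : Fin (Module.finrank 𝕜 T.range)) : (T.singularValues i : 𝕜) ≠ 0 := by
    exact_mod_cast singularValues_ne_zero T i
  have hv := b.orthonormal.comp _ (Fin.castLE_injective hle)
  refine ⟨b ∘ Fin.castLE hle, fun i => (T.singularValues i : 𝕜)⁻¹ • T (b (Fin.castLE hle i)),
    hv, ?_, fun i => T.singularValues_nonneg i, fun z => ?_⟩
  · classical
    rw [orthonormal_iff_ite] at hv ⊢
    intro i j
    simp only [Function.comp_apply] at hv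
    rw [inner_smul_left, inner_smul_right, hinner, hv i j, map_inv₀, RCLike.conj_ofReal]
    split_ifs with hij
    · subst hij
      have := hpos i
      simp only [Fin.val_castLE]
      field_simp
    · simp
  · conv_lhs => rw [← b.sum_repr' z, map_sum]
    refine (Fintype.sum_of_injective (Fin.castLE hle) (Fin.castLE_injective hle) _ _
      (fun j hj => ?_) fun i => ?_).symm
    · rw [map_smul, hnull j, smul_zero]
      refine (LinearMap.singularValues_eq_zero_iff_le_finrank_range _).2 (not_lt.1 fun hlt => ?_)
      exact hj ⟨⟨j, hlt⟩, rfl⟩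
    · rw [smul_smul, mul_right_comm, mul_inv_cancel₀ (hpos i), one_mul, map_smul]
      rfl

end SVD

section Penalty

variable {𝕜 : Type*} [RCLike 𝕜]
  {E : Type*} [NormedAddCommGroup E] [InnerProductSpace 𝕜 E] [FiniteDimensional 𝕜 E]
  {F : Type*} [NormedAddCommGroup F] [InnerProductSpace 𝕜 F] [FiniteDimensional 𝕜 F]
  {ι κ : Type*} [Fintype ι] [Fintype κ] {μ : ℝ}

/-- The spectral penalty `∑ᵢ r_μ(σᵢ(T))`, the sum being over the positive singular values. -/
def penalty (μ : ℝ) (T : E →ₗ[𝕜] F) : ℝ :=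
  ∑ i ∈ Finset.range (Module.finrank 𝕜 T.range), rPenalty μ (T.singularValues i)

lemma penalty_le_sum (hμ : 0 ≤ μ) {w : κ → E} (hw : Orthonormal 𝕜 w) {T : E →ₗ[𝕜] F}
    (hT : ∀ z, (∀ k, ⟪w k, z⟫_𝕜 = 0) → T z = 0) :
    penalty μ T ≤ ∑ k, rPenalty μ ‖T (w k)‖ := by
  obtain ⟨v, u, h⟩ := exists_isSVD T
  rw [penalty, Finset.sum_range]
  exact h.sum_rPenalty_le hμ hw hT

namespace IsSVD

variable {X D : E →ₗ[𝕜] F} {v : ι → E} {x : ι → ℝ} {u : ι → F}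

lemma penalty_eq (h : IsSVD X v x u) (hμ : 0 ≤ μ) : penalty μ X = ∑ i, rPenalty μ (x i) := by
  refine le_antisymm ?_ ?_
  · simpa only [h.norm_apply_right] using
      penalty_le_sum hμ h.orthonormal_right fun z hz => h.apply_eq_zero hz
  · obtain ⟨v', u', h'⟩ := exists_isSVD X
    rw [penalty, Finset.sum_range]
    simpa only [h'.norm_apply_right] using
      h.sum_rPenalty_le hμ h'.orthonormal_right fun z hz => h'.apply_eq_zero hz

lemma isUpperSlope_penalty (h : IsSVD X v x u) (hμ : 0 ≤ μ)
    (hD : ∀ z, (∀ i, ⟪v i, z⟫_𝕜 = 0) → D z = 0)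
    (h₀ : ∀ i, x i = 0 → ∃ d : ℝ, 0 ≤ d ∧ D (v i) = (d : 𝕜) • u i) :
    IsUpperSlope (fun t => penalty μ (X + (t : 𝕜) • D))
      (∑ i, 2 * (max (√μ - x i) 0 * RCLike.re ⟪u i, D (v i)⟫_𝕜)) := by
  refine (IsUpperSlope.sum (φ := fun i t => rPenalty μ ‖X (v i) + (t : 𝕜) • D (v i)‖)
    fun i => ?_).mono ?_ fun t _ => ?_
  · rcases eq_or_ne (x i) 0 with hi | hi
    · obtain ⟨d, hd, hDv⟩ := h₀ i hi
      have hslope := isUpperSlope_rPenalty_norm_smul (𝕜 := 𝕜) hμ (D (v i))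
      have hXv : X (v i) = 0 := by rw [h.apply_right, hi, RCLike.ofReal_zero, zero_smul]
      rw [hDv, norm_smul, h.orthonormal_left.norm_eq_one, RCLike.norm_ofReal, abs_of_nonneg hd,
        ← hDv] at hslope
      simp only [hXv, zero_add]
      convert hslope using 1
      rw [hDv, inner_smul_right, RCLike.re_ofReal_mul, inner_self_eq_norm_sq,
        h.orthonormal_left.norm_eq_one, hi, sub_zero, max_eq_left (Real.sqrt_nonneg μ)]
      ring
    · have hXv : X (v i) ≠ 0 := norm_ne_zero_iff.1 (by rwa [h.norm_apply_right])
      convert isUpperSlope_rPenalty_norm (μ := μ) hXv (D (v i)) using 1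
      rw [h.norm_apply_right, h.apply_right, inner_smul_left, RCLike.conj_ofReal,
        RCLike.re_ofReal_mul]
      field_simp
  · simp [h.penalty_eq hμ, h.norm_apply_right]
  · refine penalty_le_sum hμ h.orthonormal_right fun z hz => ?_
    simp [h.apply_eq_zero hz, hD z hz]

end IsSVD

lemma penalty_adjoint (hμ : 0 ≤ μ) (T : E →ₗ[𝕜] F) : penalty μ T.adjoint = penalty μ T := by
  obtain ⟨v, u, h⟩ := exists_isSVD T
  rw [h.penalty_eq hμ, h.adjoint.penalty_eq hμ]

end Penalty

section Overlap

variable {𝕜 : Type*} [RCLike 𝕜]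
  {E : Type*} [NormedAddCommGroup E] [InnerProductSpace 𝕜 E]
  {F : Type*} [NormedAddCommGroup F] [InnerProductSpace 𝕜 F]
  {ι κ : Type*} {X Y : E →ₗ[𝕜] F}

variable (𝕜) in
/-- The overlaps of two pairs of orthonormal families of singular vectors. The arithmetic mean is
what the AM-GM inequality leaves of the products `⟨bⱼ, vᵢ⟩ ⟨uᵢ, aⱼ⟩`. -/
def overlap (v : ι → E) (u : ι → F) (b : κ → E) (a : κ → F) (i : ι) (j : κ) : ℝ :=
  (‖⟪b j, v i⟫_𝕜‖ ^ 2 + ‖⟪u i, a j⟫_𝕜‖ ^ 2) / 2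

namespace IsSVD

variable [Fintype κ] {v : ι → E} {y : ι → ℝ} {u : ι → F} {b : κ → E} {x : κ → ℝ} {a : κ → F}

lemma re_inner_apply_le (hX : IsSVD X b x a) (v : ι → E) (u : ι → F) (i : ι) :
    RCLike.re ⟪u i, X (v i)⟫_𝕜 ≤ ∑ j, overlap 𝕜 v u b a i j * x j := by
  rw [hX.apply_eq_sum, inner_sum, map_sum]
  refine Finset.sum_le_sum fun j _ => ?_
  calc RCLike.re ⟪u i, (x j * ⟪b j, v i⟫_𝕜) • a j⟫_𝕜
      ≤ ‖⟪u i, (x j * ⟪b j, v i⟫_𝕜) • a j⟫_𝕜‖ := RCLike.re_le_norm _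
    _ = ‖⟪b j, v i⟫_𝕜‖ * ‖⟪u i, a j⟫_𝕜‖ * x j := by
        rw [inner_smul_right, norm_mul, norm_mul, RCLike.norm_ofReal, abs_of_nonneg (hX.nonneg j)]
        ring
    _ ≤ overlap 𝕜 v u b a i j * x j := by
        refine mul_le_mul_of_nonneg_right ?_ (hX.nonneg j)
        rw [overlap]
        linarith [two_mul_le_add_sq ‖⟪b j, v i⟫_𝕜‖ ‖⟪u i, a j⟫_𝕜‖]

variable [Fintype ι]

lemma isDoublySubstochastic_overlap (hX : IsSVD X b x a) (hY : IsSVD Y v y u) :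
    IsDoublySubstochastic (overlap 𝕜 v u b a) where
  nonneg i j := by unfold overlap; positivity
  row_sum_le i := by
    have hv := hX.orthonormal_right.sum_inner_products_le (v i) (s := .univ)
    have hu := hX.orthonormal_left.sum_inner_products_le (u i) (s := .univ)
    simp only [hY.orthonormal_right.norm_eq_one, hY.orthonormal_left.norm_eq_one] at hv hu
    simp only [overlap, ← Finset.sum_div, Finset.sum_add_distrib, norm_inner_symm (u i)]
    linarith
  col_sum_le j := by
    have hb := hY.orthonormal_right.sum_inner_products_le (b j) (s := .univ)
    have ha := hY.orthonormal_left.sum_inner_products_le (a j) (s := .univ)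
    simp only [hX.orthonormal_right.norm_eq_one, hX.orthonormal_left.norm_eq_one] at hb ha
    simp only [overlap, ← Finset.sum_div, Finset.sum_add_distrib, norm_inner_symm (b j)]
    linarith

lemma sum_inner_apply (hY : IsSVD Y v y u) (X : E →ₗ[𝕜] F) (e : OrthonormalBasis κ 𝕜 E) :
    ∑ k, ⟪Y (e k), X (e k)⟫_𝕜 = ∑ i, y i * ⟪u i, X (v i)⟫_𝕜 := by
  have hterm (k : κ) : ⟪Y (e k), X (e k)⟫_𝕜
      = ∑ i, y i * ⟪u i, X (⟪e k, v i⟫_𝕜 • e k)⟫_𝕜 := by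
    rw [hY.apply_eq_sum, sum_inner]
    refine Finset.sum_congr rfl fun i _ => ?_
    rw [inner_smul_left, map_mul, RCLike.conj_ofReal, inner_conj_symm, map_smul, inner_smul_right,
      mul_assoc]
  simp only [hterm]
  rw [Finset.sum_comm]
  refine Finset.sum_congr rfl fun i _ => ?_
  rw [← Finset.mul_sum, ← inner_sum, ← map_sum, e.sum_repr']

end IsSVD

end Overlap

section HilbertSchmidt

variable {𝕜 : Type*} [RCLike 𝕜]
  {E : Type*} [NormedAddCommGroup E] [InnerProductSpace 𝕜 E] [FiniteDimensional 𝕜 E]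
  {F : Type*} [NormedAddCommGroup F] [InnerProductSpace 𝕜 F] [FiniteDimensional 𝕜 F]
  {ι κ : Type*} [Fintype ι] [Fintype κ] {X Y : E →ₗ[𝕜] F} {μ c : ℝ}

/-- The square of the Hilbert–Schmidt norm, `tr(T* T)`. -/
def hsNormSq (T : E →ₗ[𝕜] F) : ℝ :=
  RCLike.re (LinearMap.trace 𝕜 E (T.adjoint ∘ₗ T))

lemma hsNormSq_eq_sum (T : E →ₗ[𝕜] F) (e : OrthonormalBasis κ 𝕜 E) :
    hsNormSq T = ∑ k, ‖T (e k)‖ ^ 2 := by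
  rw [hsNormSq, LinearMap.trace_eq_sum_inner _ e, map_sum]
  refine Finset.sum_congr rfl fun k _ => ?_
  rw [LinearMap.comp_apply, LinearMap.adjoint_inner_right, inner_self_eq_norm_sq]

namespace IsSVD

variable {v : ι → E} {y : ι → ℝ} {u : ι → F} {b : κ → E} {x : κ → ℝ} {a : κ → F}

lemma hsNormSq_eq (hY : IsSVD Y v y u) : hsNormSq Y = ∑ i, y i ^ 2 := by
  have h := hY.sum_inner_apply Y (stdOrthonormalBasis 𝕜 E)
  rw [hsNormSq_eq_sum Y (stdOrthonormalBasis 𝕜 E)]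
  simp only [inner_self_eq_norm_sq_to_K, hY.inner_left_apply, hY.orthonormal_right.norm_eq_one,
    RCLike.ofReal_one, one_pow, mul_one, ← sq] at h
  exact_mod_cast h

lemma hsNormSq_sub (hX : IsSVD X b x a) (hY : IsSVD Y v y u) : hsNormSq (X - Y)
    = ∑ i, y i ^ 2 + ∑ j, x j ^ 2 - 2 * ∑ i, y i * RCLike.re ⟪u i, X (v i)⟫_𝕜 := by
  set e := stdOrthonormalBasis 𝕜 E
  have hcross := congrArg RCLike.re (hY.sum_inner_apply X e)
  simp only [map_sum, RCLike.re_ofReal_mul] at hcross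
  rw [← hY.hsNormSq_eq, ← hX.hsNormSq_eq, ← hcross]
  simp only [hsNormSq_eq_sum _ e, LinearMap.sub_apply, Finset.mul_sum, ← Finset.sum_add_distrib,
    ← Finset.sum_sub_distrib]
  refine Finset.sum_congr rfl fun k _ => ?_
  rw [norm_sub_rev, norm_sub_sq (𝕜 := 𝕜)]
  ring

lemma sum_max_mul_re_inner_sub_le (hY : IsSVD Y v y u) (hc : 0 ≤ c) (hc₁ : c ≤ 1)
    (hX : ∀ i < Module.finrank 𝕜 X.range, √μ ≤ c * X.singularValues i) :
    ∑ i, max (√μ - y i) 0 * RCLike.re ⟪u i, (X - Y) (v i)⟫_𝕜 ≤ c * hsNormSq (X - Y) := by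
  obtain ⟨b, a, hXsvd⟩ := exists_isSVD X
  have hsub (i : ι) :
      RCLike.re ⟪u i, (X - Y) (v i)⟫_𝕜 = RCLike.re ⟪u i, X (v i)⟫_𝕜 - y i := by
    rw [LinearMap.sub_apply, inner_sub_right, hY.inner_left_apply, inner_self_eq_norm_sq_to_K,
      hY.orthonormal_right.norm_eq_one]
    simp
  simp only [hsub, hXsvd.hsNormSq_sub hY]
  exact (hXsvd.isDoublySubstochastic_overlap hY).sum_max_mul_sub_le hc hc₁ (fun j => hX j j.2)
    hY.nonneg (hXsvd.re_inner_apply_le v u)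

end IsSVD

lemma penalty_le_add_mul_hsNormSq (hμ : 0 ≤ μ) (hc : 0 ≤ c) (hc₁ : c ≤ 1)
    (hX : ∀ i < Module.finrank 𝕜 X.range, √μ ≤ c * X.singularValues i) (Y : E →ₗ[𝕜] F) :
    penalty μ X ≤ penalty μ Y + c * hsNormSq (X - Y) := by
  obtain ⟨b, a, hXsvd⟩ := exists_isSVD X
  obtain ⟨v, u, hYsvd⟩ := exists_isSVD Y
  rw [hXsvd.penalty_eq hμ, hYsvd.penalty_eq hμ, hXsvd.hsNormSq_sub hYsvd]
  exact (hXsvd.isDoublySubstochastic_overlap hYsvd).sum_rPenalty_le hμ hc hc₁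
    (fun j => hX j j.2) hYsvd.nonneg (hXsvd.re_inner_apply_le v u)

end HilbertSchmidt

section Directions

variable {𝕜 : Type*} [RCLike 𝕜]
  {E : Type*} [NormedAddCommGroup E] [InnerProductSpace 𝕜 E] [FiniteDimensional 𝕜 E]
  {F : Type*} [NormedAddCommGroup F] [InnerProductSpace 𝕜 F]
  {X D : E →ₗ[𝕜] F} {z : E} {ι : Type*} [Fintype ι] {v : ι → E} {x : ι → ℝ} {u : ι → F} {μ : ℝ}

/-- The block of `D` from `ker X` to `range X`, along which the spectral penalty is stationary
at `X`. -/
def kerToRange (X D : E →ₗ[𝕜] F) : E →ₗ[𝕜] F :=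
  X.range.starProjection.toLinearMap ∘ₗ D ∘ₗ X.ker.starProjection.toLinearMap

/-- The block of `D` from `ker X` to `(range X)ᗮ`, whose singular vectors complete those of `X`. -/
def kerToCoker (X D : E →ₗ[𝕜] F) : E →ₗ[𝕜] F :=
  X.rangeᗮ.starProjection.toLinearMap ∘ₗ D ∘ₗ X.ker.starProjection.toLinearMap

lemma kerToRange_apply_mem (X D : E →ₗ[𝕜] F) (z : E) : kerToRange X D z ∈ X.range :=
  X.range.starProjection_apply_mem _

lemma kerToCoker_apply_mem (X D : E →ₗ[𝕜] F) (z : E) : kerToCoker X D z ∈ X.rangeᗮ :=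
  X.rangeᗮ.starProjection_apply_mem _

lemma kerToRange_apply_of_mem_orthogonal (hz : z ∈ X.kerᗮ) : kerToRange X D z = 0 := by
  simp [kerToRange, X.ker.starProjection_apply_eq_zero_iff.2 hz]

lemma kerToCoker_apply_of_mem_orthogonal (hz : z ∈ X.kerᗮ) : kerToCoker X D z = 0 := by
  simp [kerToCoker, X.ker.starProjection_apply_eq_zero_iff.2 hz]

lemma sub_kerToRange_apply (hz : X z = 0) : (D - kerToRange X D) z = kerToCoker X D z := by
  have hz : X.ker.starProjection z = z := X.ker.starProjection_eq_self_iff.2 hz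
  simp [kerToRange, kerToCoker, hz, Submodule.starProjection_orthogonal_val]

lemma IsSVD.inner_left_kerToRange (h : IsSVD X v x u) (D : E →ₗ[𝕜] F) (i : ι) :
    ⟪u i, kerToRange X D (v i)⟫_𝕜 = 0 := by
  rcases eq_or_ne (x i) 0 with hi | hi
  · obtain ⟨w, hw⟩ := kerToRange_apply_mem X D (v i)
    rw [← hw, h.inner_left_apply, hi, RCLike.ofReal_zero, zero_mul]
  · rw [kerToRange_apply_of_mem_orthogonal (h.right_mem_orthogonal_ker hi), inner_zero_right]

variable [FiniteDimensional 𝕜 F]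

namespace IsSVD

lemma adjoint_kerToCoker_apply_left (h : IsSVD X v x u) (D : E →ₗ[𝕜] F) {i : ι} (hi : x i ≠ 0) :
    (kerToCoker X D).adjoint (u i) = 0 := by
  refine ext_inner_right 𝕜 fun z => ?_
  rw [LinearMap.adjoint_inner_left, inner_zero_left]
  exact kerToCoker_apply_mem X D z _ (h.left_mem_range hi)

lemma adjoint_kerToRange_apply (h : IsSVD X v x u) (D : E →ₗ[𝕜] F) {z : F}
    (hz : ∀ i, ⟪u i, z⟫_𝕜 = 0) : (kerToRange X D).adjoint z = 0 := by
  refine ext_inner_right 𝕜 fun w => ?_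
  obtain ⟨w', hw'⟩ := kerToRange_apply_mem X D w
  rw [LinearMap.adjoint_inner_left, ← hw', ← LinearMap.adjoint_inner_left,
    h.adjoint.apply_eq_zero hz]
  simp

end IsSVD

lemma isUpperSlope_penalty_kerToRange (hμ : 0 ≤ μ) (X D : E →ₗ[𝕜] F) :
    IsUpperSlope (fun t => penalty μ (X + (t : 𝕜) • kerToRange X D)) 0 := by
  obtain ⟨v, u, h⟩ := exists_isSVD X
  have hadjoint (t : ℝ) : penalty μ (X + (t : 𝕜) • kerToRange X D)
      = penalty μ (X.adjoint + (t : 𝕜) • (kerToRange X D).adjoint) := by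
    rw [← penalty_adjoint hμ, map_add, map_smulₛₗ, RCLike.conj_ofReal]
  simp only [hadjoint]
  convert h.adjoint.isUpperSlope_penalty hμ (fun z => h.adjoint_kerToRange_apply D)
    fun i hi => absurd hi (singularValues_ne_zero X i) using 1
  refine (Finset.sum_eq_zero fun i _ => ?_).symm
  rw [LinearMap.adjoint_inner_right, inner_eq_zero_symm.1 (h.inner_left_kerToRange D i)]
  simp

lemma exists_isUpperSlope_penalty_sub_kerToRange (hμ : 0 ≤ μ) (X D : E →ₗ[𝕜] F) :
    ∃ (ι : Type) (_ : Fintype ι) (v : ι → E) (x : ι → ℝ) (u : ι → F), IsSVD X v x u ∧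
      IsUpperSlope (fun t => penalty μ (X + (t : 𝕜) • (D - kerToRange X D)))
        (∑ i, 2 * (max (√μ - x i) 0 * RCLike.re ⟪u i, D (v i)⟫_𝕜)) := by
  obtain ⟨v, u, hX⟩ := exists_isSVD X
  obtain ⟨v', u', hC⟩ := exists_isSVD (kerToCoker X D)
  have h := hX.sumElim_zero hC (singularValues_ne_zero _)
    (fun i => kerToCoker_apply_of_mem_orthogonal
      (hX.right_mem_orthogonal_ker (singularValues_ne_zero X i)))
    (fun i => hX.adjoint_kerToCoker_apply_left D (singularValues_ne_zero X i))
  refine ⟨_, inferInstance, _, _, _, h, ?_⟩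
  convert h.isUpperSlope_penalty (D := D - kerToRange X D) hμ (fun z hz => ?_) ?_ using 1
  · refine Finset.sum_congr rfl fun i _ => ?_
    rw [LinearMap.sub_apply, inner_sub_right, h.inner_left_kerToRange, sub_zero]
  · rw [sub_kerToRange_apply (h.apply_eq_zero hz)]
    exact hC.apply_eq_zero fun k => hz (Sum.inr k)
  · rintro (i | k) hi
    · exact absurd hi (singularValues_ne_zero X i)
    · refine ⟨_, hC.nonneg k, ?_⟩
      rw [sub_kerToRange_apply (by simpa using h.apply_right (Sum.inr k))]
      exact hC.apply_right k

end Directions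

attribute [local instance] Matrix.frobeniusNormedAddCommGroup Matrix.frobeniusNormedSpace

section Matrices

lemma rank_sub_le {R p q : Type*} [Field R] [Finite p] [Fintype q] (X Y : Matrix p q R) :
    (X - Y).rank ≤ X.rank + Y.rank := by
  refine (Submodule.finrank_mono ?_).trans (Submodule.finrank_add_le_finrank_add_finrank _ _)
  rintro _ ⟨z, rfl⟩
  rw [Matrix.mulVecLin_apply, Matrix.sub_mulVec]
  exact Submodule.sub_mem_sup (LinearMap.mem_range_self _ z) (LinearMap.mem_range_self _ z)

variable {𝕜 : Type*} [RCLike 𝕜] {n₁ n₂ : ℕ}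

lemma rank_eq_finrank_range_toEuclideanLin (X : Matrix (Fin n₁) (Fin n₂) 𝕜) :
    X.rank = Module.finrank 𝕜 (Matrix.toEuclideanLin X).range := by
  rw [Matrix.toEuclideanLin, Matrix.toLpLin_eq_toLin]
  exact Matrix.rank_eq_finrank_range_toLin X _ _

lemma frobenius_norm_sq_eq_hsNormSq (X : Matrix (Fin n₁) (Fin n₂) 𝕜) :
    ‖X‖ ^ 2 = hsNormSq (Matrix.toEuclideanLin X) := by
  rw [hsNormSq_eq_sum _ (EuclideanSpace.basisFun (Fin n₂) 𝕜), Matrix.frobenius_norm_def,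
    ← Real.sqrt_eq_rpow, Real.sq_sqrt (by positivity), Finset.sum_comm]
  refine Finset.sum_congr rfl fun j _ => ?_
  rw [EuclideanSpace.norm_sq_eq]
  refine Finset.sum_congr rfl fun i _ => ?_
  simp [Matrix.toLpLin_apply]

end Matrices

section Functional

variable {𝕜 𝕂 : Type*} [RCLike 𝕜] [RCLike 𝕂] {n₁ n₂ m : ℕ}
  {A : Matrix (Fin n₁) (Fin n₂) 𝕜 →ₗ[ℝ] EuclideanSpace 𝕂 (Fin m)} {μ c : ℝ}
  {X₀ X Y : Matrix (Fin n₁) (Fin n₂) 𝕜}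

lemma regFunctional_eq (hμ : 0 ≤ μ)
    (A : Matrix (Fin n₁) (Fin n₂) 𝕜 →ₗ[ℝ] EuclideanSpace 𝕂 (Fin m))
    (b : EuclideanSpace 𝕂 (Fin m)) (X : Matrix (Fin n₁) (Fin n₂) 𝕜) :
    regFunctional A b μ X = penalty μ (Matrix.toEuclideanLin X) + ‖A X - b‖ ^ 2 := by
  rw [regFunctional, penalty, ← rank_eq_finrank_range_toEuclideanLin]
  congr 1
  refine (Finset.sum_subset (Finset.range_mono (le_min X.rank_le_height X.rank_le_width))
    fun i _ hi => ?_).symm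
  rw [Finset.mem_range, not_lt, rank_eq_finrank_range_toEuclideanLin] at hi
  rw [singularValue, (LinearMap.singularValues_eq_zero_iff_le_finrank_range _).2 hi,
    rPenalty_zero hμ]

lemma one_sub_lripConst_mul_norm_sq_le {k : ℕ} (hX : X.rank ≤ k) :
    (1 - lripConst A k) * ‖X‖ ^ 2 ≤ ‖A X‖ ^ 2 := by
  rcases eq_or_ne X 0 with rfl | h0
  · simp
  · rw [lripConst, sub_sub_cancel, ← le_div_iff₀ (by positivity)]
    refine csInf_le ⟨0, ?_⟩ ⟨X, h0, hX, rfl⟩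
    rintro _ ⟨Y, -, -, rfl⟩
    positivity

lemma penalty_toEuclideanLin_le (hμ : 0 ≤ μ) (hc : 0 ≤ c) (hc₁ : c ≤ 1)
    (hX₀ : ∀ i < X₀.rank, √μ ≤ c * singularValue X₀ i) (Y : Matrix (Fin n₁) (Fin n₂) 𝕜) :
    penalty μ (Matrix.toEuclideanLin X₀)
      ≤ penalty μ (Matrix.toEuclideanLin Y) + c * ‖Y - X₀‖ ^ 2 := by
  rw [rank_eq_finrank_range_toEuclideanLin] at hX₀
  rw [norm_sub_rev, frobenius_norm_sq_eq_hsNormSq, map_sub]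
  exact penalty_le_add_mul_hsNormSq hμ hc hc₁ hX₀ _

lemma isStationaryReg_self (hμ : 0 ≤ μ) (hX₀ : ∀ i < X₀.rank, √μ ≤ singularValue X₀ i) :
    IsStationaryReg A (A X₀) μ X₀ := by
  refine isStationaryPoint_of_le_add_sq fun Y => ?_
  have h := penalty_toEuclideanLin_le hμ zero_le_one le_rfl (by simpa using hX₀) Y
  rw [regFunctional_eq hμ, regFunctional_eq hμ, sub_self, norm_zero]
  linarith [sq_nonneg ‖A Y - A X₀‖]

lemma isUpperSlope_regFunctional {D : Matrix (Fin n₁) (Fin n₂) 𝕜} {β : ℝ} (hμ : 0 ≤ μ)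
    (b : EuclideanSpace 𝕂 (Fin m)) (hβ : IsUpperSlope (fun t => penalty μ
      (Matrix.toEuclideanLin X + (t : 𝕜) • Matrix.toEuclideanLin D)) β) :
    IsUpperSlope (fun t => regFunctional A b μ (X + (t : 𝕜) • D))
      (β + 2 * RCLike.re ⟪A X - b, A D⟫_𝕂) := by
  have hA (t : ℝ) : A (X + (t : 𝕜) • D) - b = A X - b + (t : 𝕂) • A D := by
    rw [map_add, ← RCLike.real_smul_eq_coe_smul, map_smul, ← RCLike.real_smul_eq_coe_smul,
      add_sub_right_comm]
  have hT (t : ℝ) : Matrix.toEuclideanLin (X + (t : 𝕜) • D)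
      = Matrix.toEuclideanLin X + (t : 𝕜) • Matrix.toEuclideanLin D := by
    rw [map_add, map_smul]
  simpa only [regFunctional_eq hμ, hA, hT] using
    hβ.add (isUpperSlope_norm_sq (𝕜 := 𝕂) (A X - b) (A D))

lemma norm_sq_map_sub_le_of_isStationaryReg (hμ : 0 ≤ μ) (hc : 0 ≤ c) (hc₁ : c ≤ 1)
    (hX₀ : ∀ i < X₀.rank, √μ ≤ c * singularValue X₀ i) (hX : IsStationaryReg A (A X₀) μ X) :
    ‖A (X - X₀)‖ ^ 2 ≤ c * ‖X - X₀‖ ^ 2 := by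
  set T := Matrix.toEuclideanLin X
  set D := X₀ - X with hD
  obtain ⟨D₂, hD₂⟩ := Matrix.toEuclideanLin.surjective (kerToRange T (Matrix.toEuclideanLin D))
  obtain ⟨ι, _, v, x, u, hsvd, hslope⟩ :=
    exists_isUpperSlope_penalty_sub_kerToRange hμ T (Matrix.toEuclideanLin D)
  have hslope₂ := isUpperSlope_penalty_kerToRange hμ T (Matrix.toEuclideanLin D)
  rw [← hD₂, ← map_sub] at hslope
  rw [← hD₂] at hslope₂
  have hnonneg := hX.nonneg_of_isUpperSlope (isUpperSlope_regFunctional hμ (A X₀) hslope)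
  have hnonneg₂ := hX.nonneg_of_isUpperSlope (isUpperSlope_regFunctional hμ (A X₀) hslope₂)
  have hdata : RCLike.re ⟪A X - A X₀, A (D - D₂)⟫_𝕂 + RCLike.re ⟪A X - A X₀, A D₂⟫_𝕂
      = -‖A (X - X₀)‖ ^ 2 := by
    rw [← map_add, ← inner_add_right, ← map_add, sub_add_cancel, ← map_sub, hD, ← neg_sub X X₀,
      map_neg, inner_neg_right, map_neg, inner_self_eq_norm_sq]
  rw [rank_eq_finrank_range_toEuclideanLin] at hX₀
  have hpenalty := hsvd.sum_max_mul_re_inner_sub_le hc hc₁ hX₀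
  rw [← map_sub, ← frobenius_norm_sq_eq_hsNormSq, norm_sub_rev] at hpenalty
  rw [← Finset.mul_sum] at hnonneg
  linarith

variable {K : ℕ}

lemma mul_norm_sub_sq_lt (hc : c < 1 - lripConst A (2 * K)) (hX : X.rank ≤ K) (hY : Y.rank ≤ K)
    (hXY : X ≠ Y) : c * ‖X - Y‖ ^ 2 < ‖A (X - Y)‖ ^ 2 := by
  have hpos : 0 < ‖X - Y‖ := norm_pos_iff.2 (sub_ne_zero.2 hXY)
  calc c * ‖X - Y‖ ^ 2 < (1 - lripConst A (2 * K)) * ‖X - Y‖ ^ 2 := by gcongr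
    _ ≤ ‖A (X - Y)‖ ^ 2 :=
      one_sub_lripConst_mul_norm_sq_le ((rank_sub_le X Y).trans (by lia))

lemma regFunctional_lt (hμ : 0 ≤ μ) (hc : 0 ≤ c) (hc₁ : c ≤ 1)
    (hcA : c < 1 - lripConst A (2 * K)) (hX₀ : ∀ i < X₀.rank, √μ ≤ c * singularValue X₀ i)
    (hrank : X₀.rank ≤ K) (hY : Y.rank ≤ K) (hne : Y ≠ X₀) :
    regFunctional A (A X₀) μ X₀ < regFunctional A (A X₀) μ Y := by
  rw [regFunctional_eq hμ, regFunctional_eq hμ, sub_self, norm_zero, ← map_sub]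
  linarith [penalty_toEuclideanLin_le hμ hc hc₁ hX₀ Y, mul_norm_sub_sq_lt hcA hY hrank hne]

lemma lt_rank_of_isStationaryReg (hμ : 0 ≤ μ) (hc : 0 ≤ c) (hc₁ : c ≤ 1)
    (hcA : c < 1 - lripConst A (2 * K)) (hX₀ : ∀ i < X₀.rank, √μ ≤ c * singularValue X₀ i)
    (hrank : X₀.rank ≤ K) (hX : IsStationaryReg A (A X₀) μ X) (hne : X ≠ X₀) : K < X.rank :=
  lt_of_not_ge fun hXrank => (mul_norm_sub_sq_lt hcA hXrank hrank hne).not_ge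
    (norm_sq_map_sub_le_of_isStationaryReg hμ hc hc₁ hX₀ hX)

end Functional

end LowRank

end

theorem theorem1p2 {𝕜 𝕂 : Type*} [RCLike 𝕜] [RCLike 𝕂] {n₁ n₂ m : ℕ}
    (A : Matrix (Fin n₁) (Fin n₂) 𝕜 →ₗ[ℝ] EuclideanSpace 𝕂 (Fin m))
    (b : EuclideanSpace 𝕂 (Fin m)) (X₀ : Matrix (Fin n₁) (Fin n₂) 𝕜)
    (K : ℕ) (μ : ℝ) (hK : 1 ≤ K) (hμ : 0 ≤ μ)
    (hb : b = A X₀) (hrank : X₀.rank = K)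
    (hδ_pos : 0 < LowRank.lripConst A (2 * K)) (hδ_lt : LowRank.lripConst A (2 * K) < 1)
    (hσ : √μ / (1 - LowRank.lripConst A (2 * K)) < LowRank.singularValue X₀ (K - 1)) :
    LowRank.IsStationaryReg A b μ X₀ ∧
    {X : Matrix (Fin n₁) (Fin n₂) 𝕜 | X.rank ≤ K ∧
        ∀ Y : Matrix (Fin n₁) (Fin n₂) 𝕜, Y.rank ≤ K →
          LowRank.regFunctional A b μ X ≤ LowRank.regFunctional A b μ Y} = {X₀} ∧
    ∀ X : Matrix (Fin n₁) (Fin n₂) 𝕜,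
      LowRank.IsStationaryReg A b μ X → X ≠ X₀ → K < X.rank := by
  subst hb
  set δ := LowRank.lripConst A (2 * K)
  set σ := LowRank.singularValue X₀ (K - 1)
  have hδ : 0 < 1 - δ := sub_pos.2 hδ_lt
  have hσ₀ : 0 < σ := (div_nonneg (Real.sqrt_nonneg μ) hδ.le).trans_lt hσ
  have hc : 0 ≤ √μ / σ := by positivity
  have hcδ : √μ / σ < 1 - δ := (div_lt_comm₀ hδ hσ₀).1 hσ
  have hc₁ : √μ / σ ≤ 1 := by linarith
  have hX₀ : ∀ i < X₀.rank, √μ ≤ √μ / σ * LowRank.singularValue X₀ i := fun i hi =>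
    calc √μ = √μ / σ * σ := (div_mul_cancel₀ _ hσ₀.ne').symm
      _ ≤ √μ / σ * LowRank.singularValue X₀ i :=
        mul_le_mul_of_nonneg_left (LinearMap.singularValues_antitone _ (by lia)) hc
  have hmin : ∀ Y : Matrix (Fin n₁) (Fin n₂) 𝕜, Y.rank ≤ K → Y ≠ X₀ →
      LowRank.regFunctional A (A X₀) μ X₀ < LowRank.regFunctional A (A X₀) μ Y :=
    fun Y => LowRank.regFunctional_lt hμ hc hc₁ hcδ hX₀ hrank.le
  refine ⟨LowRank.isStationaryReg_self hμ fun i hi => (hX₀ i hi).trans ?_,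
    Set.eq_singleton_iff_unique_mem.2 ⟨⟨hrank.le, fun Y hY => ?_⟩, fun X hX => ?_⟩,
    fun X => LowRank.lt_rank_of_isStationaryReg hμ hc hc₁ hcδ hX₀ hrank.le⟩
  · exact mul_le_of_le_one_left (LinearMap.singularValues_nonneg _ i) hc₁
  · exact (eq_or_ne Y X₀).elim (fun h => h ▸ le_rfl) fun h => (hmin Y hY h).le
  · exact not_imp_comm.1 (hmin X hX.1) (hX.2 X₀ hrank.le).not_gt
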